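/- Let $K$ be a field, let $G$ be a finite simple graph with vertex set $\{v_1,\dots,v_n\}$, let $S=K[x_1,\dots,x_n]$, and let $I=I(G)\subseteq S$ be the edge ideal of $G$, generated by the monomials $x_ix_j$ with $\{v_i,v_j\}$ an edge of $G$. Let $p$ be the number of connected components of $G$ that are bipartite (isolated vertices included). Then for every integer $k\ge 1$, $$\operatorname{sdepth}(S/I^k)\ \ge\ p .$$ Here, for a finitely generated $\mathbb{Z}^n$-graded $S$-module $M$, a Stanley space of dimension $|Z|$ is a $K$-subspace $uK[Z]=\{uf : f\in K[Z]\}$ of $M$, with $u\in M$ a non-zero homogeneous element and $Z\subseteq\{x_1,\dots,x_n\}$, that is a free $K[Z]$-module; a Stanley decomposition of $M$ is a decomposition of $M$ as a finite direct sum of Stanley spaces (as a $K$-vector space); the Stanley depth of a decomposition is the minimum dimension of its Stanley spaces; and $\operatorname{sdepth}(M)$ is the maximum of the Stanley depths of all Stanley decompositions of $M$. -/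

import Mathlib

open MvPolynomial

noncomputable section

/-- The edge ideal of a graph `G` in the polynomial ring `K[x_v : v ∈ V]`, generated by the
monomials `x_v x_w` over the edges `{v, w}` of `G`. -/
def edgeIdeal {V : Type*} (K : Type*) [Field K] (G : SimpleGraph V) : Ideal (MvPolynomial V K) :=
  Ideal.span {f | ∃ v w : V, G.Adj v w ∧ f = X v * X w}

/-- The number of connected components of `G` which are bipartite graphs (an isolated vertex is
such a component). -/
def numBipartiteComponents {V : Type*} (G : SimpleGraph V) : ℕ :=
  Nat.card {c : G.ConnectedComponent // c.toSimpleGraph.IsBipartite}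

/-- The `ℤ^V`-grading of the quotient `S ⧸ J` of `S = K[x_v : v ∈ V]` (for a monomial ideal `J`):
the component of degree `a` is the image of that of `S`, where `x_v` has as its degree the
`v`-th unit vector. -/
def quotientGrading {V K : Type*} [Field K] (J : Ideal (MvPolynomial V K)) (a : V →₀ ℤ) :
    Submodule K (MvPolynomial V K ⧸ J) :=
  (weightedHomogeneousSubmodule K (fun v : V => Finsupp.single v (1 : ℤ)) a).map
    (Ideal.Quotient.mkₐ K J).toLinearMap

section StanleyDepth

variable {V K M : Type*} [Field K] [AddCommGroup M] [Module K M] [Module (MvPolynomial V K) M]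
  [IsScalarTower K (MvPolynomial V K) M]

/-- The `K`-subspace `u K[Z]` of `M`, generated by all `f • u` with `f ∈ K[Z]`. -/
def stanleySubspace (u : M) (Z : Finset V) : Submodule K M :=
  (Submodule.span (supported K (Z : Set V)) {u}).restrictScalars K

/-- A Stanley decomposition of a module `M` over `K[x_v : v ∈ V]` with grading `𝓜`: a finite
family of subspaces `u_i K[Z_i]` with `u_i` non-zero and homogeneous, each of them free as a
`K[Z_i]`-module, of which `M` is the direct sum as a `K`-vector space. -/
structure StanleyDecomposition (𝓜 : (V →₀ ℤ) → Submodule K M) where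
  /-- the number of Stanley spaces -/
  r : ℕ
  /-- the generators -/
  u : Fin r → M
  /-- the sets of variables -/
  Z : Fin r → Finset V
  homogeneous : ∀ i, ∃ a, u i ∈ 𝓜 a
  ne_zero : ∀ i, u i ≠ 0
  free : ∀ i, Module.Free (supported K (Z i : Set V))
    (Submodule.span (supported K (Z i : Set V)) {u i})
  isInternal : DirectSum.IsInternal fun i => stanleySubspace (K := K) (u i) (Z i)

/-- The Stanley depth of a Stanley decomposition: the least dimension `|Z_i|` of its Stanley
spaces (`⊤` for the empty decomposition of the zero module). -/
def StanleyDecomposition.sdepth {𝓜 : (V →₀ ℤ) → Submodule K M} (D : StanleyDecomposition 𝓜) :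
    WithBot ℕ∞ :=
  ⨅ i, ((D.Z i).card : WithBot ℕ∞)

/-- The Stanley depth of the graded module `M`: the largest Stanley depth of a Stanley
decomposition of `M` (it would be `⊥` if there were none). -/
def stanleyDepth (𝓜 : (V →₀ ℤ) → Submodule K M) : WithBot ℕ∞ :=
  ⨆ D : StanleyDecomposition 𝓜, D.sdepth

end StanleyDepth

end

/-! Call a multiset of edges that contains every vertex `v` at most `a v` times a `b`-matching with
the capacities `a`. The monomial `x^a` lies in `I(G)^k` iff the maximal sizes of such
`b`-matchings of the components of `G`, cut off at `k`, add up to at least `k`.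

For a nonempty bipartite graph, the weighted form of Kőnig's theorem gives a vertex outside some
vertex cover of least weight, and raising its capacity does not change the maximal size of a
`b`-matching. Raising the capacity of the first such vertex does not create new ones, so that
vertex remains the first; hence the vectors `a` are partitioned into cones with at least one
direction each, on which the maximal size is constant. The products of these cones over the
components have at least one direction per bipartite component, and each of them lies either inside
or outside `I(G)^k`; the ones outside form the Stanley decomposition. -/

open scoped Pointwise

/-- The exponent vectors of the monomials in `x^b K[Z]`. -/
def exponentCone {V : Type*} (b : V → ℕ) (Z : Set V) : Set (V → ℕ) :=
  {a | b ≤ a ∧ Set.EqOn a b Zᶜ}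

theorem self_mem_exponentCone {V : Type*} (b : V → ℕ) (Z : Set V) : b ∈ exponentCone b Z :=
  ⟨le_rfl, fun _ _ => rfl⟩

theorem coe_mem_exponentCone_iff {V : Type*} {a b : V →₀ ℕ} {Z : Set V} :
    ⇑a ∈ exponentCone b Z ↔ ∃ z : V →₀ ℕ, ↑z.support ⊆ Z ∧ z + b = a := by
  constructor
  · rintro ⟨hle, heq⟩
    refine ⟨a - b, fun u hu => ?_, tsub_add_cancel_of_le hle⟩
    by_contra huZ
    simp [heq huZ] at hu
  · rintro ⟨z, hz, rfl⟩
    refine ⟨fun u => by simp, fun u hu => ?_⟩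
    have : z u = 0 := Finsupp.notMem_support_iff.1 fun h => hu (hz h)
    simp [this]

theorem free_span_singleton_of_smul_eq_zero {R M : Type*} [Ring R] [AddCommGroup M] [Module R M]
    {u : M} (hu : ∀ r : R, r • u = 0 → r = 0) : Module.Free R (Submodule.span R {u}) := by
  rw [← LinearMap.range_toSpanSingleton]
  exact Module.Free.of_equiv (LinearEquiv.ofInjective (LinearMap.toSpanSingleton R M u)
    ((injective_iff_map_eq_zero _).2 hu))

section MonomialIdeal

section CommSemiring

variable {V R : Type*} [CommSemiring R]

theorem mem_supported_iff_support_subset {Z : Set V} {f : MvPolynomial V R} :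
    f ∈ supported R Z ↔ f ∈ restrictSupport R {z : V →₀ ℕ | ↑z.support ⊆ Z} := by
  simp only [mem_supported, mem_restrictSupport_iff, Set.subset_def, Finset.mem_coe,
    mem_vars_iff_mem_support, Set.mem_ofPred_eq]
  exact ⟨fun h z hz v hv => h v ⟨z, hz, hv⟩, fun h v ⟨z, hz, hv⟩ => h z hz v hv⟩

theorem span_pow_monomial_image (E : Set (V →₀ ℕ)) (k : ℕ) :
    Ideal.span ((fun e => monomial e (1 : R)) '' E) ^ k =
      Ideal.span ((fun e => monomial e (1 : R)) '' (k • E)) := by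
  induction k with
  | zero => simp
  | succ k ih =>
    rw [pow_succ, ih, Ideal.span_mul_span', succ_nsmul]
    congr 1
    ext f
    simp [Set.mem_mul, Set.mem_add, monomial_mul]

theorem mem_restrictSupportIdeal_iff {U : Set (V →₀ ℕ)} (hU : IsUpperSet U)
    {f : MvPolynomial V R} :
    f ∈ restrictSupportIdeal R U hU ↔ ∀ m ∈ f.support, m ∈ U :=
  Iff.rfl

end CommSemiring

section CommRing

variable {V R : Type*} [CommRing R] {U : Set (V →₀ ℕ)} (hU : IsUpperSet U)
include hU

theorem linearIndependent_mk_monomial :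
    LinearIndependent R fun m : ↥Uᶜ =>
      Ideal.Quotient.mk (restrictSupportIdeal R U hU) (monomial m.1 1) := by
  refine ((basisMonomials V R).linearIndependent.comp _ Subtype.val_injective).map
    (f := (Ideal.Quotient.mkₐ R (restrictSupportIdeal R U hU)).toLinearMap) ?_
  have hspan : Submodule.span R (Set.range (basisMonomials V R ∘ ((↑) : ↥Uᶜ → V →₀ ℕ))) =
      restrictSupport R Uᶜ := by
    rw [restrictSupport_eq_span, Set.range_comp, Subtype.range_coe, coe_basisMonomials]
  rw [hspan, Submodule.disjoint_def]
  intro f hfU hf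
  replace hf : f ∈ restrictSupportIdeal R U hU := Ideal.Quotient.eq_zero_iff_mem.1 hf
  by_contra hne
  obtain ⟨m, hm⟩ := support_nonempty.2 hne
  exact hfU hm (hf hm)

theorem span_mk_monomial_eq_top :
    Submodule.span R (Set.range fun m : ↥Uᶜ =>
      Ideal.Quotient.mk (restrictSupportIdeal R U hU) (monomial m.1 1)) = ⊤ := by
  rw [eq_top_iff]
  rintro y -
  obtain ⟨f, rfl⟩ := Ideal.Quotient.mk_surjective y
  induction f using MvPolynomial.induction_on' with
  | monomial m r =>
    by_cases hm : m ∈ U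
    · rw [Ideal.Quotient.eq_zero_iff_mem.2]
      · exact Submodule.zero_mem _
      · exact (mem_restrictSupportIdeal_iff hU).2 fun m' hm' =>
          Finset.mem_singleton.1 (support_monomial_subset hm') ▸ hm
    · have hr : Ideal.Quotient.mk (restrictSupportIdeal R U hU) (monomial m r) =
          r • Ideal.Quotient.mk (restrictSupportIdeal R U hU) (monomial m 1) := by
        rw [← mul_one r, ← smul_eq_mul, ← smul_monomial, smul_eq_mul, mul_one]
        rfl
      rw [hr]
      exact Submodule.smul_mem _ _ (Submodule.subset_span ⟨⟨m, hm⟩, rfl⟩)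
  | add f g hf hg =>
    rw [map_add]
    exact Submodule.add_mem _ hf hg

theorem eq_zero_of_mul_monomial_mem {b : V →₀ ℕ} {Z : Set V}
    (hbU : ∀ m : V →₀ ℕ, ⇑m ∈ exponentCone b Z → m ∉ U) {f : MvPolynomial V R}
    (hf : f ∈ supported R Z) (hfb : f * monomial b 1 ∈ restrictSupportIdeal R U hU) : f = 0 := by
  by_contra hne
  obtain ⟨z, hz⟩ := support_nonempty.2 hne
  refine hbU (z + b)
    (coe_mem_exponentCone_iff.2 ⟨z, mem_supported_iff_support_subset.1 hf hz, rfl⟩)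
    ((mem_restrictSupportIdeal_iff hU).1 hfb _ ?_)
  rwa [mem_support_iff, coeff_mul_monomial, mul_one, ← mem_support_iff]

end CommRing

variable {V K : Type*} [Field K]

theorem stanleySubspace_mk_monomial (J : Ideal (MvPolynomial V K)) (b : V →₀ ℕ) (Z : Finset V) :
    stanleySubspace (K := K) (Ideal.Quotient.mk J (monomial b 1)) Z =
      Submodule.span K ((fun m => Ideal.Quotient.mk J (monomial m 1)) ''
        {m : V →₀ ℕ | ⇑m ∈ exponentCone b Z}) := by
  let mulMonomial : MvPolynomial V K →ₗ[K] MvPolynomial V K ⧸ J :=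
    (Ideal.Quotient.mkₐ K J).toLinearMap ∘ₗ LinearMap.mulRight K (monomial b 1)
  have hmap : stanleySubspace (K := K) (Ideal.Quotient.mk J (monomial b 1)) Z =
      (restrictSupport K {z : V →₀ ℕ | ↑z.support ⊆ (Z : Set V)}).map mulMonomial := by
    ext y
    simp only [stanleySubspace, Submodule.restrictScalars_mem, Submodule.mem_span_singleton,
      Submodule.mem_map, Subtype.exists, ← mem_supported_iff_support_subset]
    exact ⟨fun ⟨f, hf, h⟩ => ⟨f, hf, h⟩, fun ⟨f, hf, h⟩ => ⟨f, hf, h⟩⟩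
  rw [hmap, restrictSupport_eq_span, Submodule.map_span, Set.image_image]
  congr 1
  ext y
  simp [mulMonomial, coe_mem_exponentCone_iff, monomial_mul]

theorem mk_monomial_mem_quotientGrading (J : Ideal (MvPolynomial V K)) (b : V →₀ ℕ) :
    ∃ a, Ideal.Quotient.mk J (monomial b (1 : K)) ∈ quotientGrading J a :=
  ⟨_, monomial b 1, isWeightedHomogeneous_monomial _ b 1 rfl, rfl⟩

variable {U : Set (V →₀ ℕ)} (hU : IsUpperSet U)
include hU

theorem isInternal_stanleySubspace_mk_monomial {ι : Type*} [DecidableEq ι] {b : ι → V →₀ ℕ}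
    {Z : ι → Finset V} (hbU : ∀ i, ∀ m : V →₀ ℕ, ⇑m ∈ exponentCone (b i) (Z i) → m ∉ U)
    (hpart : ∀ m ∉ U, ∃! i, ⇑m ∈ exponentCone (b i) (Z i)) :
    DirectSum.IsInternal fun i => stanleySubspace (K := K)
      (Ideal.Quotient.mk (restrictSupportIdeal K U hU) (monomial (b i) 1)) (Z i) := by
  let cone (i : ι) : Set ↥Uᶜ := {m | ⇑m.1 ∈ exponentCone (b i) (Z i)}
  have hcone : ∀ i, stanleySubspace (K := K)
      (Ideal.Quotient.mk (restrictSupportIdeal K U hU) (monomial (b i) 1)) (Z i) =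
        Submodule.span K ((fun m : ↥Uᶜ =>
          Ideal.Quotient.mk (restrictSupportIdeal K U hU) (monomial m.1 1)) '' cone i) := by
    intro i
    rw [stanleySubspace_mk_monomial]
    congr 1
    ext y
    exact ⟨fun ⟨m, hm, h⟩ => ⟨⟨m, hbU i m hm⟩, hm, h⟩, fun ⟨m, hm, h⟩ => ⟨m, hm, h⟩⟩
  simp_rw [hcone]
  refine DirectSum.isInternal_submodule_of_iSupIndep_of_iSup_eq_top (fun i => ?_) ?_
  · simp_rw [← Submodule.span_iUnion, ← Set.image_iUnion]
    refine (linearIndependent_mk_monomial hU).disjoint_span_image (Set.disjoint_left.2 ?_)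
    intro m hi hm
    obtain ⟨j, hji, hj⟩ := Set.mem_iUnion₂.1 hm
    exact hji ((hpart m.1 m.2).unique hj hi)
  · have hcover : ⋃ i, cone i = Set.univ := Set.eq_univ_of_forall fun m =>
      Set.mem_iUnion.2 (hpart m.1 m.2).exists
    rw [← Submodule.span_iUnion, ← Set.image_iUnion, hcover, Set.image_univ,
      span_mk_monomial_eq_top]

theorem le_stanleyDepth_of_exponentCones {ι : Type*} [Finite ι] {b : ι → V →₀ ℕ}
    {Z : ι → Finset V} {n : ℕ} (hn : ∀ i, n ≤ (Z i).card)
    (hbU : ∀ i, ∀ m : V →₀ ℕ, ⇑m ∈ exponentCone (b i) (Z i) → m ∉ U)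
    (hpart : ∀ m ∉ U, ∃! i, ⇑m ∈ exponentCone (b i) (Z i)) :
    (n : WithBot ℕ∞) ≤ stanleyDepth (quotientGrading (restrictSupportIdeal K U hU)) := by
  obtain ⟨r, ⟨e⟩⟩ := Finite.exists_equiv_fin ι
  let D : StanleyDecomposition (quotientGrading (restrictSupportIdeal K U hU)) :=
    { r := r
      u := fun i => Ideal.Quotient.mk _ (monomial (b (e.symm i)) 1)
      Z := fun i => Z (e.symm i)
      homogeneous := fun _ => mk_monomial_mem_quotientGrading _ _
      ne_zero := fun i => (linearIndependent_mk_monomial hU).ne_zero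
        ⟨b (e.symm i), hbU _ _ (self_mem_exponentCone _ _)⟩
      free := fun _ => free_span_singleton_of_smul_eq_zero fun f hf => Subtype.ext <|
        eq_zero_of_mul_monomial_mem hU (hbU _) f.2 (Ideal.Quotient.eq_zero_iff_mem.1 hf)
      isInternal := isInternal_stanleySubspace_mk_monomial hU (fun _ => hbU _) fun m hm =>
        e.symm.existsUnique_congr_right.2 (hpart m hm) }
  exact le_iSup_of_le D (le_iInf fun i => by exact_mod_cast hn (e.symm i))

end MonomialIdeal

/-- A partition of `ℕ^V` into cones with base points in `[0, k]^V`. It is encoded by the maps that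
send a vector to the base point and to the set of directions of the cone containing it. -/
structure ConePartition (V : Type*) (k : ℕ) where
  /-- the base point of the cone containing a vector -/
  base : (V → ℕ) → V → ℕ
  /-- the directions of the cone containing a vector -/
  dirs : (V → ℕ) → Set V
  base_le : ∀ a v, base a v ≤ k
  self_mem : ∀ a, a ∈ exponentCone (base a) (dirs a)
  base_eq : ∀ {a b}, b ∈ exponentCone (base a) (dirs a) → base b = base a
  dirs_eq : ∀ {a b}, b ∈ exponentCone (base a) (dirs a) → dirs b = dirs a

namespace ConePartition

variable {V : Type*} {k : ℕ}

/-- The cone of the partition that contains `a`. -/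
def cone (P : ConePartition V k) (a : V → ℕ) : Set (V → ℕ) :=
  exponentCone (P.base a) (P.dirs a)

theorem base_mem_cone (P : ConePartition V k) (a : V → ℕ) : P.base a ∈ P.cone a :=
  self_mem_exponentCone _ _

theorem base_base (P : ConePartition V k) (a : V → ℕ) : P.base (P.base a) = P.base a :=
  P.base_eq (P.base_mem_cone a)

theorem mem_cone_comm (P : ConePartition V k) {a b : V → ℕ} : b ∈ P.cone a ↔ a ∈ P.cone b := by
  have symm {a b : V → ℕ} (h : b ∈ P.cone a) : a ∈ P.cone b := by
    rw [cone, P.base_eq h, P.dirs_eq h]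
    exact P.self_mem a
  exact ⟨symm, symm⟩

theorem le_stanleyDepth [Finite V] {K : Type*} [Field K] (P : ConePartition V k)
    {U : Set (V →₀ ℕ)} (hU : IsUpperSet U) (hPU : ∀ a b : V →₀ ℕ, ⇑b ∈ P.cone a → b ∈ U → a ∈ U)
    {n : ℕ} (hn : ∀ a, n ≤ (P.dirs a).ncard) :
    (n : WithBot ℕ∞) ≤ stanleyDepth (quotientGrading (restrictSupportIdeal K U hU)) := by
  -- The cones of the partition that avoid `U`, each represented by its base point.
  let ι := {b : V →₀ ℕ // b ∉ U ∧ P.base b = b}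
  have : Finite ι := by
    have : Finite {b : V → ℕ // ∀ v, b v ≤ k} :=
      (Set.Finite.pi' fun _ : V => Set.finite_Iic k).to_subtype
    refine Finite.of_injective (β := {b : V → ℕ // ∀ v, b v ≤ k})
      (fun b => ⟨b.1, fun v => ?_⟩) fun b c h => ?_
    · rw [← b.2.2]
      exact P.base_le _ v
    · exact Subtype.ext (DFunLike.coe_injective (congrArg Subtype.val h))
  have hcone (b : ι) : exponentCone b.1 ((P.dirs b.1).toFinite.toFinset : Set V) = P.cone b.1 := by
    rw [cone, b.2.2, Set.Finite.coe_toFinset]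
  refine le_stanleyDepth_of_exponentCones hU (ι := ι) (b := fun b => b.1)
    (Z := fun b => (P.dirs b.1).toFinite.toFinset) (fun b => ?_) (fun b m hm hmU => ?_)
    (fun m hm => ?_)
  · rw [← Set.ncard_eq_toFinset_card]
    exact hn b.1
  · rw [hcone] at hm
    exact b.2.1 (hPU _ _ hm hmU)
  · simp_rw [hcone]
    let c : V →₀ ℕ := Finsupp.equivFunOnFinite.symm (P.base m)
    have hc : ⇑c = P.base m := rfl
    have hcm : ⇑c ∈ P.cone m := P.base_mem_cone m
    refine ⟨⟨c, fun hcU => hm (hPU _ _ hcm hcU), hc ▸ P.base_base m⟩, P.mem_cone_comm.1 hcm,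
      fun b hb => Subtype.ext (DFunLike.coe_injective ?_)⟩
    rw [hc, P.base_eq hb, b.2.2]

theorem apply_eq_of_inf_const_eq {Λ : Type*} {F : (V → ℕ) → Λ}
    (hF : ∀ a, F (a ⊓ fun _ => k) = F a) {a b : V → ℕ} (h : ∀ u, min (a u) k = min (b u) k) :
    F a = F b := by
  rw [← hF a, ← hF b]
  exact congrArg F (funext h)

section Truncation

theorem mem_exponentCone_inf_const_iff {a b : V → ℕ} :
    b ∈ exponentCone (a ⊓ fun _ => k) {v | k ≤ a v} ↔ b ⊓ (fun _ => k) = a ⊓ fun _ => k := by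
  simp only [exponentCone, Set.mem_ofPred_eq, Pi.le_def, Set.EqOn, Set.mem_compl_iff, funext_iff,
    Pi.inf_apply, ← forall_and]
  exact forall_congr' fun v => by omega

variable (V k) in
/-- The partition of `ℕ^V` into the fibres of the truncation `a ↦ a ⊓ k`. -/
def truncation : ConePartition V k where
  base a := a ⊓ fun _ => k
  dirs a := {v | k ≤ a v}
  base_le _ _ := inf_le_right
  self_mem _ := mem_exponentCone_inf_const_iff.2 rfl
  base_eq h := mem_exponentCone_inf_const_iff.1 h
  dirs_eq h := by
    rw [mem_exponentCone_inf_const_iff, funext_iff] at h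
    ext v
    have := h v
    simp only [Pi.inf_apply] at this
    simp only [Set.mem_ofPred_eq]
    omega

theorem mem_cone_truncation_iff {a b : V → ℕ} :
    b ∈ (truncation V k).cone a ↔ b ⊓ (fun _ => k) = a ⊓ fun _ => k :=
  mem_exponentCone_inf_const_iff

end Truncation

section Rays

open Function (update)

variable [DecidableEq V] {Λ : Type*} {L : (V → ℕ) → Λ} {s : Λ → V}

/-- The least value of the coordinate `s (L a)` for which the label remains `L a` when the other
coordinates of `a` are kept. -/
noncomputable def rayStart (L : (V → ℕ) → Λ) (s : Λ → V) (a : V → ℕ) : ℕ :=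
  sInf {t | L (update a (s (L a)) t) = L a}

theorem label_update_rayStart (a : V → ℕ) : L (update a (s (L a)) (rayStart L s a)) = L a :=
  Nat.sInf_mem (s := {t | L (update a (s (L a)) t) = L a}) ⟨a (s (L a)), by simp⟩

theorem label_update_of_rayStart_le
    (hs : ∀ a t, a (s (L a)) ≤ t → L (update a (s (L a)) t) = L a) {a : V → ℕ} {t : ℕ}
    (ht : rayStart L s a ≤ t) : L (update a (s (L a)) t) = L a := by
  have h := hs (update a (s (L a)) (rayStart L s a)) t
  rw [label_update_rayStart (L := L) a, Function.update_self, Function.update_idem] at h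
  exact h ht

theorem rayStart_le (hL : ∀ a, L (a ⊓ fun _ => k) = L a) (a : V → ℕ) :
    rayStart L s a ≤ min (a (s (L a))) k := by
  refine Nat.sInf_le (apply_eq_of_inf_const_eq hL fun u => ?_)
  rcases eq_or_ne u (s (L a)) with rfl | hu
  · simp
  · simp [hu]

theorem mem_exponentCone_update_inf_const_iff {a b : V → ℕ} {v : V} {r : ℕ} :
    b ∈ exponentCone (update (a ⊓ fun _ => k) v r) (insert v {u | k ≤ a u}) ↔
      r ≤ b v ∧ ∀ u ≠ v, min (b u) k = min (a u) k := by
  simp only [exponentCone, Set.mem_ofPred_eq, Pi.le_def, Set.EqOn, Set.mem_compl_iff,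
    Set.mem_insert_iff]
  constructor
  · rintro ⟨hle, heq⟩
    refine ⟨by simpa using hle v, fun u hu => ?_⟩
    have hle := hle u
    have heq := @heq u
    simp only [Function.update_of_ne hu, Pi.inf_apply, hu, false_or] at hle heq
    omega
  · rintro ⟨hr, h⟩
    refine ⟨fun u => ?_, fun u hu => ?_⟩
    · rcases eq_or_ne u v with rfl | hu
      · simpa using hr
      · simp [hu, ← h u hu]
    · rw [not_or] at hu
      have := h u hu.1
      simp only [Function.update_of_ne hu.1, Pi.inf_apply]
      omega

theorem label_update_congr (hL : ∀ a, L (a ⊓ fun _ => k) = L a) {a b : V → ℕ} {v : V}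
    (h : ∀ u ≠ v, min (b u) k = min (a u) k) (t : ℕ) : L (update b v t) = L (update a v t) := by
  refine apply_eq_of_inf_const_eq hL fun u => ?_
  rcases eq_or_ne u v with rfl | hu
  · simp
  · simpa [hu] using h u hu

theorem label_eq_of_rayStart_le (hL : ∀ a, L (a ⊓ fun _ => k) = L a)
    (hs : ∀ a t, a (s (L a)) ≤ t → L (update a (s (L a)) t) = L a) {a b : V → ℕ}
    (hr : rayStart L s a ≤ b (s (L a))) (h : ∀ u ≠ s (L a), min (b u) k = min (a u) k) :
    L b = L a := by
  have hb := label_update_congr hL h (b (s (L a)))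
  rwa [Function.update_eq_self, label_update_of_rayStart_le hs hr] at hb

theorem rayStart_congr (hL : ∀ a, L (a ⊓ fun _ => k) = L a) {a b : V → ℕ} (hab : L b = L a)
    (h : ∀ u ≠ s (L a), min (b u) k = min (a u) k) : rayStart L s b = rayStart L s a := by
  simp only [rayStart, hab, label_update_congr hL h]

/-- The partition obtained from a labelling `L` that depends only on the truncation of its argument
and does not change when the coordinate `s (L a)` of `a` is raised. A cone consists of vectors with
the same label and with the same truncated coordinates other than `s (L a)`. -/
noncomputable def ofLabelling (L : (V → ℕ) → Λ) (s : Λ → V) (hL : ∀ a, L (a ⊓ fun _ => k) = L a)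
    (hs : ∀ a t, a (s (L a)) ≤ t → L (update a (s (L a)) t) = L a) : ConePartition V k where
  base a := update (a ⊓ fun _ => k) (s (L a)) (rayStart L s a)
  dirs a := insert (s (L a)) {u | k ≤ a u}
  base_le a u := by
    rcases eq_or_ne u (s (L a)) with rfl | hu
    · simpa using (rayStart_le hL a).trans (min_le_right _ _)
    · simp [hu]
  self_mem a := mem_exponentCone_update_inf_const_iff.2
    ⟨(rayStart_le hL a).trans (min_le_left _ _), fun _ _ => rfl⟩
  base_eq {a b} hb := by
    obtain ⟨hr, h⟩ := mem_exponentCone_update_inf_const_iff.1 hb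
    have hab := label_eq_of_rayStart_le hL hs hr h
    funext u
    rw [hab, rayStart_congr hL hab h]
    rcases eq_or_ne u (s (L a)) with rfl | hu
    · simp
    · simpa [hu] using h u hu
  dirs_eq {a b} hb := by
    obtain ⟨hr, h⟩ := mem_exponentCone_update_inf_const_iff.1 hb
    rw [label_eq_of_rayStart_le hL hs hr h]
    ext u
    rcases eq_or_ne u (s (L a)) with rfl | hu
    · simp
    · have := h u hu
      simp only [Set.mem_insert_iff, hu, false_or, Set.mem_ofPred_eq]
      omega

theorem label_eq_of_mem_cone_ofLabelling (hL : ∀ a, L (a ⊓ fun _ => k) = L a)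
    (hs : ∀ a t, a (s (L a)) ≤ t → L (update a (s (L a)) t) = L a) {a b : V → ℕ}
    (hb : b ∈ (ofLabelling L s hL hs).cone a) : L b = L a :=
  have ⟨hr, h⟩ := mem_exponentCone_update_inf_const_iff.1 hb
  label_eq_of_rayStart_le hL hs hr h

end Rays

open Function (update) in
theorem exists_of_forall_exists_free {Λ : Type*} [PartialOrder Λ] [DecidableEq V]
    {F : (V → ℕ) → Λ} (hmono : Monotone F) (htrunc : ∀ a, F (a ⊓ fun _ => k) = F a)
    (hfree : ∀ a, ∃ v, ∀ t, F (update a v t) ≤ F a) :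
    ∃ P : ConePartition V k, (∀ a, (P.dirs a).Nonempty) ∧ ∀ a, ∀ b ∈ P.cone a, F b = F a := by
  obtain ⟨_, _⟩ := exists_wellFoundedLT V
  let free (a : V → ℕ) : Set V := {v | ∀ t, F (update a v t) ≤ F a}
  have hwf : WellFounded ((· < ·) : V → V → Prop) := wellFounded_lt
  let first (a : V → ℕ) : V := hwf.min (free a) (hfree a)
  let L (a : V → ℕ) : Λ × V := (F a, first a)
  have free_trunc (a : V → ℕ) : free (a ⊓ fun _ => k) = free a := by
    ext v
    simp only [free, Set.mem_ofPred_eq, htrunc,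
      label_update_congr htrunc (a := a) (b := a ⊓ fun _ => k) (v := v) fun u _ => by simp]
  have hL (a : V → ℕ) : L (a ⊓ fun _ => k) = L a := by
    simp only [L, first, free_trunc, htrunc]
  have hs (a : V → ℕ) (t : ℕ) (ht : a (first a) ≤ t) : L (update a (first a) t) = L a := by
    have hF : F (update a (first a) t) = F a :=
      (hwf.min_mem _ (hfree a) t).antisymm (hmono (le_update_self_iff.2 ht))
    have hmem : first a ∈ free (update a (first a) t) := fun t' => by
      rw [Function.update_idem, hF]
      exact hwf.min_mem _ (hfree a) t'
    have hsub : free (update a (first a) t) ⊆ free a := fun w hw t' =>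
      (hmono (update_le_update_iff.2 ⟨le_rfl, fun u _ => le_update_self_iff.2 ht u⟩)).trans
        ((hw t').trans hF.le)
    exact Prod.ext hF (hwf.min_eq_of_forall_not_lt hmem fun w hw =>
      hwf.not_lt_min (free a) (hsub hw))
  exact ⟨ofLabelling L Prod.snd hL hs, fun a => Set.insert_nonempty _ _, fun a b hb =>
    congrArg Prod.fst (label_eq_of_mem_cone_ofLabelling hL hs hb)⟩

section Glue

variable {C : Type*} {W : C → Type*}

theorem mem_exponentCone_sigma_iff (e : (Σ c, W c) ≃ V) (P : ∀ c, ConePartition (W c) k)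
    {a b : V → ℕ} :
    b ∈ exponentCone
        (fun v => (P (e.symm v).1).base (fun w => a (e ⟨_, w⟩)) (e.symm v).2)
        {v | (e.symm v).2 ∈ (P (e.symm v).1).dirs fun w => a (e ⟨_, w⟩)} ↔
      ∀ c, (fun w => b (e ⟨c, w⟩)) ∈ (P c).cone fun w => a (e ⟨c, w⟩) := by
  have reindex (p : V → (Σ c, W c) → Prop) :
      (∀ v, p v (e.symm v)) ↔ ∀ c w, p (e ⟨c, w⟩) ⟨c, w⟩ := by
    rw [← e.forall_congr_right]
    simp only [Equiv.symm_apply_apply, Sigma.forall]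
  let a' (c : C) (w : W c) : ℕ := a (e ⟨c, w⟩)
  exact (and_congr (reindex fun v x => (P x.1).base (a' x.1) x.2 ≤ b v)
    (reindex fun v x => x.2 ∉ (P x.1).dirs (a' x.1) → b v = (P x.1).base (a' x.1) x.2)).trans
    forall_and.symm

/-- The partition of `ℕ^V` into the products of the cones of partitions of `ℕ^(W c)`, for a
decomposition of `V` into parts `W c`. -/
def glue (e : (Σ c, W c) ≃ V) (P : ∀ c, ConePartition (W c) k) : ConePartition V k where
  base a v := (P (e.symm v).1).base (fun w => a (e ⟨_, w⟩)) (e.symm v).2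
  dirs a := {v | (e.symm v).2 ∈ (P (e.symm v).1).dirs fun w => a (e ⟨_, w⟩)}
  base_le _ _ := (P _).base_le _ _
  self_mem _ := (mem_exponentCone_sigma_iff e P).2 fun c => (P c).self_mem _
  base_eq h := funext fun _ => congrFun ((P _).base_eq ((mem_exponentCone_sigma_iff e P).1 h _)) _
  dirs_eq h := Set.ext fun v =>
    Set.ext_iff.1 ((P _).dirs_eq ((mem_exponentCone_sigma_iff e P).1 h (e.symm v).1)) _

theorem mem_cone_glue_iff (e : (Σ c, W c) ≃ V) (P : ∀ c, ConePartition (W c) k) {a b : V → ℕ} :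
    b ∈ (glue e P).cone a ↔
      ∀ c, (fun w => b (e ⟨c, w⟩)) ∈ (P c).cone fun w => a (e ⟨c, w⟩) :=
  mem_exponentCone_sigma_iff e P

theorem card_le_ncard_dirs_glue [Finite V] (e : (Σ c, W c) ≃ V) (P : ∀ c, ConePartition (W c) k)
    {B : C → Prop} (hB : ∀ c, B c → ∀ a, ((P c).dirs a).Nonempty) (a : V → ℕ) :
    Nat.card {c // B c} ≤ ((glue e P).dirs a).ncard := by
  choose w hw using fun c : {c // B c} => hB c c.2 fun w => a (e ⟨c, w⟩)
  rw [← Nat.card_coe_set_eq]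
  have hmem (c : {c // B c}) : e ⟨c, w c⟩ ∈ (glue e P).dirs a := by
    simp only [glue, Set.mem_ofPred_eq]
    rw [e.symm_apply_apply]
    exact hw c
  refine Nat.card_le_card_of_injective
    (fun c => (⟨e ⟨c, w c⟩, hmem c⟩ : (glue e P).dirs a)) fun c d h => ?_
  exact Subtype.ext (congrArg Sigma.fst (e.injective (congrArg Subtype.val h)))

end Glue

end ConePartition

section Hall

open Finset

variable {ι α : Type*} [Fintype ι] [DecidableEq ι] [DecidableEq α] (t : ι → Finset α)

theorem exists_injective_of_card_le_card_biUnion_add {d : ℕ}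
    (ht : ∀ s : Finset ι, #s ≤ #(s.biUnion t) + d) :
    ∃ (m : Finset ι) (g : m → α), Function.Injective g ∧ (∀ i : m, g i ∈ t i) ∧ #mᶜ ≤ d := by
  -- Adjoin `d` new elements to every `t i` and apply Hall's theorem.
  obtain ⟨f, hf, hft⟩ := (all_card_le_biUnion_card_iff_exists_injective
      fun i => (t i).disjSum (univ : Finset (Fin d))).1 fun s => by
    rcases s.eq_empty_or_nonempty with rfl | ⟨i, hi⟩
    · simp
    have hsub : (s.biUnion t).disjSum (univ : Finset (Fin d)) ⊆
        s.biUnion fun i => (t i).disjSum univ := by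
      rintro (x | x) hx
      · simpa using hx
      · simpa using ⟨i, hi⟩
    calc #s ≤ #(s.biUnion t) + d := ht s
      _ = #((s.biUnion t).disjSum (univ : Finset (Fin d))) := by simp
      _ ≤ _ := card_le_card hsub
  let m : Finset ι := univ.filter fun i => (f i).isLeft
  have hm (i : m) : (f i).isLeft := (mem_filter.1 i.2).2
  refine ⟨m, fun i => (f i).getLeft (hm i), fun i j hij => ?_, fun i => ?_, ?_⟩
  · refine Subtype.ext (hf ?_)
    rw [← Sum.inl_getLeft (f i) (hm i), ← Sum.inl_getLeft (f j) (hm j)]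
    exact congrArg Sum.inl hij
  · rw [← inl_mem_disjSum, Sum.inl_getLeft]
    exact hft i
  · have hsub : mᶜ.image f ⊆ univ.image Sum.inr := by
      intro x hx
      obtain ⟨i, hi, rfl⟩ := mem_image.1 hx
      have : (f i).isRight := by simpa [m] using hi
      exact mem_image.2 ⟨(f i).getRight this, mem_univ _, Sum.inr_getRight _ _⟩
    calc #mᶜ = #(mᶜ.image f) := (card_image_of_injective _ hf).symm
      _ ≤ #(univ.image Sum.inr) := card_le_card hsub
      _ ≤ d := card_image_le.trans (by simp)

theorem exists_injective_card_compl_add_card_biUnion_le :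
    ∃ (s m : Finset ι) (g : m → α), Function.Injective g ∧ (∀ i : m, g i ∈ t i) ∧
      #sᶜ + #(s.biUnion t) ≤ #m := by
  obtain ⟨s, -, hs⟩ := exists_max_image (univ : Finset (Finset ι))
    (fun s => (#s : ℤ) - #(s.biUnion t)) univ_nonempty
  obtain ⟨d, hd⟩ := Int.eq_ofNat_of_zero_le
    (show (0 : ℤ) ≤ #s - #(s.biUnion t) by simpa using hs ∅ (mem_univ _))
  obtain ⟨m, g, hg, hgt, hm⟩ := exists_injective_of_card_le_card_biUnion_add t (d := d) fun s' => by
    have := hs s' (mem_univ _)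
    omega
  refine ⟨s, m, g, hg, hgt, ?_⟩
  have := card_compl_add_card m
  have := card_compl_add_card s
  omega

end Hall

section BMatching

open Finsupp (single)

@[elab_as_elim]
theorem mem_nsmul_induction {M : Type*} [AddCommMonoid M] {E : Set M}
    {p : (j : ℕ) → (x : M) → x ∈ j • E → Prop}
    (zero : p 0 0 (by simp))
    (add : ∀ j x e (hx : x ∈ j • E) (he : e ∈ E),
      p j x hx → p (j + 1) (x + e) (succ_nsmul E j ▸ Set.add_mem_add hx he))
    {j : ℕ} {x : M} (hx : x ∈ j • E) : p j x hx := by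
  induction j generalizing x with
  | zero =>
    obtain rfl : x = 0 := by simpa using hx
    exact zero
  | succ j ih =>
    obtain ⟨y, hy, e, he, rfl⟩ : x ∈ j • E + E := succ_nsmul E j ▸ hx
    exact add j y e hy he (ih hy)

/-- The exponent vectors of the generators `x_v x_w` of the edge ideal of `G`. -/
def edgeExponents {V : Type*} (G : SimpleGraph V) : Set (V →₀ ℕ) :=
  {e | ∃ v w, G.Adj v w ∧ e = single v 1 + single w 1}

/-- There is a `b`-matching of size `j` with the capacities `b = a`: a multiset of `j` edges of `G`
of which at most `a v` contain the vertex `v`. The multiset is represented by its vector of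
degrees. -/
def HasBMatching {V : Type*} (G : SimpleGraph V) (j : ℕ) (a : V → ℕ) : Prop :=
  ∃ e ∈ j • edgeExponents G, ⇑e ≤ a

variable {V : Type*} {G : SimpleGraph V} {i j k : ℕ} {a b : V → ℕ}

theorem edgeIdeal_eq_span_monomial (K : Type*) [Field K] (G : SimpleGraph V) :
    edgeIdeal K G = Ideal.span ((fun e => monomial e (1 : K)) '' edgeExponents G) := by
  rw [edgeIdeal]
  congr 1
  ext f
  constructor
  · rintro ⟨v, w, hvw, rfl⟩
    exact ⟨_, ⟨v, w, hvw, rfl⟩, by simp [X, monomial_mul]⟩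
  · rintro ⟨_, ⟨v, w, hvw, rfl⟩, rfl⟩
    exact ⟨v, w, hvw, by simp [X, monomial_mul]⟩

theorem hasBMatching_zero : HasBMatching G 0 a :=
  ⟨0, by simp, fun _ => Nat.zero_le _⟩

theorem hasBMatching_one_of_adj {v w : V} (h : G.Adj v w) :
    HasBMatching G 1 ⇑(single v 1 + single w 1 : V →₀ ℕ) :=
  ⟨_, by rw [one_nsmul]; exact ⟨v, w, h, rfl⟩, le_rfl⟩

theorem HasBMatching.mono (h : HasBMatching G j a) (hab : a ≤ b) : HasBMatching G j b :=
  let ⟨e, he, hea⟩ := h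
  ⟨e, he, hea.trans hab⟩

theorem HasBMatching.add (ha : HasBMatching G i a) (hb : HasBMatching G j b) :
    HasBMatching G (i + j) (a + b) := by
  obtain ⟨e, he, hea⟩ := ha
  obtain ⟨f, hf, hfb⟩ := hb
  refine ⟨e + f, ?_, add_le_add hea hfb⟩
  rw [add_nsmul]
  exact Set.add_mem_add he hf

theorem HasBMatching.sum {ι : Type*} {s : Finset ι} {n : ι → ℕ} {a : ι → V → ℕ}
    (h : ∀ i ∈ s, HasBMatching G (n i) (a i)) :
    HasBMatching G (∑ i ∈ s, n i) (∑ i ∈ s, a i) := by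
  classical
  induction s using Finset.induction_on with
  | empty => exact hasBMatching_zero
  | insert i s hi ih =>
    rw [Finset.sum_insert hi, Finset.sum_insert hi]
    exact (h i (Finset.mem_insert_self i s)).add
      (ih fun i' hi' => h i' (Finset.mem_insert_of_mem hi'))

theorem HasBMatching.of_le (h : HasBMatching G j a) (hij : i ≤ j) : HasBMatching G i a := by
  obtain ⟨e, he, hea⟩ := h
  rw [← Nat.add_sub_cancel' hij, add_nsmul] at he
  obtain ⟨e₁, he₁, e₂, -, rfl⟩ := he
  exact ⟨e₁, he₁, le_trans (fun v => Nat.le_add_right _ _) hea⟩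

theorem apply_le_of_mem_nsmul_edgeExponents {e : V →₀ ℕ} (he : e ∈ j • edgeExponents G) (v : V) :
    e v ≤ j := by
  classical
  induction he using mem_nsmul_induction with
  | zero => rfl
  | add j x e _ he ih =>
    obtain ⟨u, w, huw, rfl⟩ := he
    have := huw.ne
    simp only [Finsupp.add_apply, Finsupp.single_apply]
    grind

theorem HasBMatching.inf_const (h : HasBMatching G j a) (hjk : j ≤ k) :
    HasBMatching G j (a ⊓ fun _ => k) :=
  let ⟨e, he, hea⟩ := h
  ⟨e, he, le_inf hea fun v => (apply_le_of_mem_nsmul_edgeExponents he v).trans hjk⟩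

theorem HasBMatching.le_sum_of_isVertexCover {S : Finset V} (hS : G.IsVertexCover S)
    (h : HasBMatching G j a) : j ≤ ∑ v ∈ S, a v := by
  classical
  obtain ⟨e, he, hea⟩ := h
  refine le_trans ?_ (Finset.sum_le_sum fun v _ => hea v)
  clear hea
  induction he using mem_nsmul_induction with
  | zero => exact Nat.zero_le _
  | add j x e _ he ih =>
    obtain ⟨u, w, huw, rfl⟩ := he
    have hone : 1 ≤ ∑ v ∈ S, (single u 1 + single w 1 : V →₀ ℕ) v := by
      simp only [Finsupp.add_apply, Finset.sum_add_distrib, Finsupp.single_apply,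
        Finset.sum_ite_eq]
      have := hS huw
      simp only [Finset.mem_coe] at this
      grind
    exact (add_le_add ih hone).trans_eq Finset.sum_add_distrib.symm

theorem isUpperSet_hasBMatching (G : SimpleGraph V) (k : ℕ) :
    IsUpperSet {m : V →₀ ℕ | HasBMatching G k m} :=
  fun _ _ hle h => h.mono hle

theorem edgeIdeal_pow (K : Type*) [Field K] (G : SimpleGraph V) (k : ℕ) :
    edgeIdeal K G ^ k = restrictSupportIdeal K _ (isUpperSet_hasBMatching G k) := by
  ext f
  rw [edgeIdeal_eq_span_monomial, span_pow_monomial_image, mem_ideal_span_monomial_image]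
  rfl

variable {W : Type*} {H : SimpleGraph W}

theorem HasBMatching.extend {a : W → ℕ} (f : H →g G) (hf : Function.Injective f)
    (h : HasBMatching H j a) : HasBMatching G j (Function.extend f a 0) := by
  obtain ⟨e, he, hea⟩ := h
  have hmap : e.mapDomain f ∈ j • edgeExponents G := by
    clear hea
    induction he using mem_nsmul_induction with
    | zero => simp
    | add j x e _ he ih =>
      obtain ⟨u, w, huw, rfl⟩ := he
      rw [succ_nsmul, Finsupp.mapDomain_add]
      refine Set.add_mem_add ih ⟨f u, f w, f.map_adj huw, ?_⟩
      simp [Finsupp.mapDomain_add, Finsupp.mapDomain_single]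
  refine ⟨_, hmap, fun v => ?_⟩
  by_cases hv : v ∈ Set.range f
  · obtain ⟨w, rfl⟩ := hv
    rw [Finsupp.mapDomain_apply hf, hf.extend_apply]
    exact hea w
  · simp [Finsupp.mapDomain_of_notMem_range _ _ hv]

theorem sum_single_fst_le {ι : Type*} [Fintype ι] {h : ι → Σ v, Fin (a v)}
    (hh : Function.Injective h) : ⇑(∑ i, single (h i).1 1) ≤ a := by
  classical
  intro v
  have hinj : Function.Injective fun i : {i // (h i).1 = v} => i.2 ▸ (h i).2 := by
    rintro ⟨i, rfl⟩ ⟨j, hj⟩ hij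
    exact Subtype.ext (hh (Sigma.ext hj.symm (by grind)))
  calc (∑ i, single (h i).1 1 : V →₀ ℕ) v = Fintype.card {i // (h i).1 = v} := by
        simp [Finsupp.single_apply, Fintype.card_subtype]
    _ ≤ a v := by simpa using Fintype.card_le_of_injective _ hinj

theorem hasBMatching_of_injective {ι : Type*} [Fintype ι] {f g : ι → Σ v, Fin (a v)}
    (hfg : Function.Injective (Sum.elim f g)) (hadj : ∀ i, G.Adj (f i).1 (g i).1) :
    HasBMatching G (Fintype.card ι) a := by
  refine ⟨∑ i, (single (f i).1 1 + single (g i).1 1), ?_, ?_⟩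
  · rw [← Finset.card_univ, ← Finset.sum_const]
    exact Set.finsetSum_mem_finsetSum _ _ _ fun i _ => ⟨_, _, hadj i, rfl⟩
  · simpa [Finset.sum_add_distrib] using sum_single_fst_le hfg

theorem isVertexCover_of_coloring (φ : G.Coloring (Fin 2)) (A : Set V) :
    G.IsVertexCover {v | (φ v = 0 ∧ v ∉ A) ∨ ∃ w ∈ A, φ w = 0 ∧ G.Adj w v} := by
  have cover_of_color_zero {v w} (hv : φ v = 0) (hvw : G.Adj v w) :
      (φ v = 0 ∧ v ∉ A) ∨ ∃ u ∈ A, φ u = 0 ∧ G.Adj u w := by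
    by_cases hvA : v ∈ A
    · exact Or.inr ⟨v, hvA, hv, hvw⟩
    · exact Or.inl ⟨hv, hvA⟩
  intro v w hvw
  have hne := φ.valid hvw
  rcases (by omega : φ v = 0 ∨ φ w = 0) with hv | hw
  · exact (cover_of_color_zero hv hvw).imp Or.inl Or.inr
  · exact (cover_of_color_zero hw hvw.symm).symm.imp Or.inr Or.inl

theorem exists_isVertexCover_hasBMatching [Finite V] (hG : G.IsBipartite) (a : V → ℕ) :
    ∃ S : Finset V, G.IsVertexCover S ∧ HasBMatching G (∑ v ∈ S, a v) a := by
  classical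
  cases nonempty_fintype V
  obtain ⟨φ⟩ := hG
  -- Split every vertex `v` into `a v` copies, each to be matched at most once.
  let t (x : Σ v, Fin (a v)) : Finset (Σ v, Fin (a v)) :=
    Finset.univ.filter fun y => φ x.1 = 0 ∧ G.Adj x.1 y.1
  have ht {x y} : y ∈ t x ↔ φ x.1 = 0 ∧ G.Adj x.1 y.1 := by simp [t]
  obtain ⟨s, m, g, hg, hgt, hcard⟩ := exists_injective_card_compl_add_card_biUnion_le t
  have hmatching : HasBMatching G (Fintype.card m) a := by
    refine hasBMatching_of_injective (f := (↑)) (g := g) ?_ fun i => (ht.1 (hgt i)).2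
    refine Subtype.val_injective.sumElim hg fun i j hij => ?_
    obtain ⟨hj, hadj⟩ := ht.1 (hgt j)
    exact φ.valid hadj (hj.trans (hij ▸ (ht.1 (hgt i)).1).symm)
  let A : Set V := Sigma.fst '' (s : Set (Σ v, Fin (a v)))
  let S : Finset V := {v | (φ v = 0 ∧ v ∉ A) ∨ ∃ w ∈ A, φ w = 0 ∧ G.Adj w v}.toFinite.toFinset
  have hS : S.sigma (fun v => (Finset.univ : Finset (Fin (a v)))) ⊆ sᶜ ∪ s.biUnion t := by
    intro y hy
    rw [Finset.mem_union, Finset.mem_compl, Finset.mem_biUnion]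
    rcases (Set.Finite.mem_toFinset _).1 (Finset.mem_sigma.1 hy).1 with ⟨-, hyA⟩ | ⟨_, hwA, h⟩
    · exact Or.inl fun hys => hyA ⟨y, hys, rfl⟩
    · obtain ⟨x, hx, rfl⟩ := hwA
      exact Or.inr ⟨x, hx, ht.2 h⟩
  have hcover : G.IsVertexCover S := by
    rw [Set.Finite.coe_toFinset]
    exact isVertexCover_of_coloring φ A
  refine ⟨S, hcover, hmatching.of_le ?_⟩
  calc ∑ v ∈ S, a v = (S.sigma fun v => (Finset.univ : Finset (Fin (a v)))).card := by simp
    _ ≤ _ := (Finset.card_le_card hS).trans (Finset.card_union_le _ _)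
    _ ≤ Fintype.card m := hcard.trans_eq (Fintype.card_coe m).symm

theorem exists_isVertexCover_subset_ne_univ [Nonempty V] {S : Set V} (hS : G.IsVertexCover S) :
    ∃ T ⊆ S, G.IsVertexCover T ∧ ∃ v, v ∉ T := by
  by_cases h : ∃ v, v ∉ S
  · exact ⟨S, subset_rfl, hS, h⟩
  · push Not at h
    have v := Classical.arbitrary V
    exact ⟨{v}ᶜ, fun w _ => h w, by simp [SimpleGraph.isVertexCover_compl], v, by simp⟩

theorem exists_free_vertex [Finite V] [Nonempty V] [DecidableEq V] (hG : G.IsBipartite)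
    (a : V → ℕ) :
    ∃ v, ∀ t j, HasBMatching G j (Function.update a v t) → HasBMatching G j a := by
  obtain ⟨S, hS, hmatching⟩ := exists_isVertexCover_hasBMatching hG a
  obtain ⟨T, hTS, hT, v, hv⟩ := exists_isVertexCover_subset_ne_univ hS
  lift T to Finset V using T.toFinite
  refine ⟨v, fun t j h => hmatching.of_le ?_⟩
  calc j ≤ ∑ w ∈ T, Function.update a v t w := h.le_sum_of_isVertexCover hT
    _ = ∑ w ∈ T, a w := Finset.sum_update_of_notMem hv _ _
    _ ≤ ∑ w ∈ S, a w := Finset.sum_le_sum_of_subset hTS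

open scoped Classical in
/-- The largest size of a `b`-matching of `G` with the capacities `b = a`, cut off at `k`. -/
noncomputable def bMatchingNumber (G : SimpleGraph V) (k : ℕ) (a : V → ℕ) : ℕ :=
  Nat.findGreatest (fun j => HasBMatching G j a) k

theorem bMatchingNumber_le : bMatchingNumber G k a ≤ k := by
  classical exact Nat.findGreatest_le k

theorem hasBMatching_bMatchingNumber : HasBMatching G (bMatchingNumber G k a) a := by
  classical
  exact Nat.findGreatest_spec (P := fun j => HasBMatching G j a) (Nat.zero_le k) hasBMatching_zero

theorem HasBMatching.le_bMatchingNumber (h : HasBMatching G j a) (hjk : j ≤ k) :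
    j ≤ bMatchingNumber G k a := by
  classical exact Nat.le_findGreatest hjk h

theorem bMatchingNumber_mono : Monotone (bMatchingNumber G k) := fun _ _ hab =>
  (hasBMatching_bMatchingNumber.mono hab).le_bMatchingNumber bMatchingNumber_le

theorem bMatchingNumber_inf_const (a : V → ℕ) :
    bMatchingNumber G k (a ⊓ fun _ => k) = bMatchingNumber G k a :=
  (bMatchingNumber_mono inf_le_left).antisymm
    ((hasBMatching_bMatchingNumber.inf_const bMatchingNumber_le).le_bMatchingNumber
      bMatchingNumber_le)

theorem exists_conePartition_bMatchingNumber [Finite V] [Nonempty V] (G : SimpleGraph V) (k : ℕ) :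
    ∃ P : ConePartition V k, (G.IsBipartite → ∀ a, (P.dirs a).Nonempty) ∧
      ∀ a, ∀ b ∈ P.cone a, bMatchingNumber G k b = bMatchingNumber G k a := by
  classical
  by_cases hG : G.IsBipartite
  · obtain ⟨P, hP, hconst⟩ := ConePartition.exists_of_forall_exists_free
      (bMatchingNumber_mono (G := G)) (bMatchingNumber_inf_const (k := k)) fun a => by
        obtain ⟨v, hv⟩ := exists_free_vertex hG a
        exact ⟨v, fun t => (hv t _ hasBMatching_bMatchingNumber).le_bMatchingNumber
          bMatchingNumber_le⟩
    exact ⟨P, fun _ => hP, hconst⟩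
  · refine ⟨ConePartition.truncation V k, fun h => absurd h hG, fun a b hb => ?_⟩
    rw [← bMatchingNumber_inf_const, ConePartition.mem_cone_truncation_iff.1 hb,
      bMatchingNumber_inf_const]

theorem HasBMatching.of_components [Fintype G.ConnectedComponent] {n : G.ConnectedComponent → ℕ}
    (h : ∀ c, HasBMatching c.toSimpleGraph (n c) fun v : c => a v) :
    HasBMatching G (∑ c, n c) a := by
  classical
  refine (HasBMatching.sum fun c _ => (h c).extend c.toSimpleGraph_hom
    Subtype.val_injective).mono fun v => ?_
  rw [Finset.sum_apply, Finset.sum_eq_single_of_mem (G.connectedComponentMk v) (Finset.mem_univ _)]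
  · exact (Subtype.val_injective.extend_apply _ _
      (⟨v, rfl⟩ : (G.connectedComponentMk v).supp)).le
  · rintro c - hc
    refine Function.extend_apply' _ _ _ ?_
    rintro ⟨⟨w, hw⟩, rfl⟩
    exact hc hw.symm

theorem exists_component_hasBMatching [Fintype G.ConnectedComponent] (h : HasBMatching G j a) :
    ∃ n : G.ConnectedComponent → ℕ, ∑ c, n c = j ∧
      ∀ c, HasBMatching c.toSimpleGraph (n c) fun v : c => a v := by
  classical
  obtain ⟨e, he, hea⟩ := h
  suffices ∃ n : G.ConnectedComponent → ℕ, ∑ c, n c = j ∧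
      ∀ c, HasBMatching c.toSimpleGraph (n c) fun v : c => e v from
    this.imp fun n hn => ⟨hn.1, fun c => (hn.2 c).mono fun v => hea v⟩
  clear hea
  induction he using mem_nsmul_induction with
  | zero => exact ⟨0, by simp, fun c => hasBMatching_zero⟩
  | add j x e _ he ih =>
    obtain ⟨n, hn, h⟩ := ih
    obtain ⟨v, w, hvw, rfl⟩ := he
    refine ⟨n + Pi.single (G.connectedComponentMk v) 1, ?_, fun c => ?_⟩
    · simp [Finset.sum_add_distrib, hn]
    rcases eq_or_ne c (G.connectedComponentMk v) with rfl | hc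
    · let v' : G.connectedComponentMk v := ⟨v, rfl⟩
      let w' : G.connectedComponentMk v :=
        ⟨w, (SimpleGraph.ConnectedComponent.connectedComponentMk_eq_of_adj hvw).symm⟩
      have hadj : (G.connectedComponentMk v).toSimpleGraph.Adj v' w' := hvw
      convert (h _).add (hasBMatching_one_of_adj hadj) using 1
      · simp
      · ext u
        simp [Finsupp.single_apply, Subtype.ext_iff, v', w']
    · rw [Pi.add_apply, Pi.single_eq_of_ne hc, add_zero]
      exact (h c).mono fun u => Nat.le_add_right _ _

theorem hasBMatching_iff_le_sum_components [Fintype G.ConnectedComponent] :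
    HasBMatching G k a ↔
      k ≤ ∑ c : G.ConnectedComponent, bMatchingNumber c.toSimpleGraph k fun v : c => a v := by
  constructor
  · intro h
    obtain ⟨n, rfl, hn⟩ := exists_component_hasBMatching h
    exact Finset.sum_le_sum fun c hc =>
      (hn c).le_bMatchingNumber (Finset.single_le_sum (fun _ _ => Nat.zero_le _) hc)
  · exact (HasBMatching.of_components fun c => hasBMatching_bMatchingNumber).of_le

end BMatching

theorem theorem2p3 {V : Type*} [Finite V] {K : Type*} [Field K] (G : SimpleGraph V)
    (k : ℕ) (hk : 1 ≤ k) :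
    (numBipartiteComponents G : WithBot ℕ∞) ≤ stanleyDepth (quotientGrading (edgeIdeal K G ^ k)) := by
  have := Fintype.ofFinite G.ConnectedComponent
  have (c : G.ConnectedComponent) : Nonempty c := c.nonempty_supp.to_subtype
  choose P hdirs hconst using fun c : G.ConnectedComponent =>
    exists_conePartition_bMatchingNumber c.toSimpleGraph k
  let e : (Σ c : G.ConnectedComponent, c) ≃ V := Equiv.sigmaFiberEquiv G.connectedComponentMk
  rw [edgeIdeal_pow]
  refine (ConePartition.glue e P).le_stanleyDepth _ (fun a b hb h => ?_)
    (ConePartition.card_le_ncard_dirs_glue e P hdirs)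
  rw [Set.mem_ofPred_eq, hasBMatching_iff_le_sum_components] at h ⊢
  refine h.trans_eq (Finset.sum_congr rfl fun c _ => ?_)
  exact hconst c _ _ ((ConePartition.mem_cone_glue_iff e P).1 hb c)
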